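/- **Theorem (Type preservation for MLTS).** Fix datatype declarations: type names $b$, some of them declared open, and constructors $C : A_1,\dots,A_n\to b$. *Types* are $A ::= \mathtt{int}\mid b\mid A\to A\mid A\Rightarrow A\mid A*A$; the judgment $\mathrm{open}\,A$ holds iff $A$ is a type name declared open. *Syntax* (up to $\alpha$-conversion; nominals are variables, written $X,Y,Z$): expressions $M ::= x\mid \mathrm{lam}\,x.M\mid M\,N\mid \mathrm{let}\,x=M\,\mathrm{in}\,N\mid \mathrm{fix}\,x.M\mid \mathrm{new}\,X.M\mid X\backslash M\mid M@N\mid C(M_1,\dots,M_n)\mid (M,N)\mid \mathrm{match}\,M\,[R_1,\dots,R_k]\mid i\mid M\mathbin{op}N$, with $i$ an integer literal and $op\in\{+,-,\times\}$; clauses $R ::= \mathrm{all}\,x.R\mid \mathrm{nab}\,Z.R\mid p\Longrightarrow M$; patterns $p ::= \mathrm{pvar}\,M\mid \mathrm{pnom}\,M\mid C(p_1,\dots,p_n)\mid (p,q)\mid X\backslash p\mid p@M\mid i\mid \_$. In source programs $\mathrm{pvar}$ is applied to pattern variables, bound by $\mathrm{all}$, and $\mathrm{pnom}$ and the right of $@$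 in patterns to nominals. *Typing* $\Gamma\vdash M:A$ is the usual simply typed (monomorphic) discipline for variables, functions, $\mathrm{let}$, $\mathrm{fix}$, constructors, pairs and integers, together with: $\Gamma\vdash X\backslash M:A\Rightarrow B$ if $\Gamma,X{:}A\vdash M:B$ and $\mathrm{open}\,A$; $\Gamma\vdash M@N:B$ if $\Gamma\vdash M:A\Rightarrow B$ and $\Gamma\vdash N:A$; $\Gamma\vdash\mathrm{new}\,X.M:B$ if $\Gamma,X{:}A\vdash M:B$ and $\mathrm{open}\,A$ for some $A$; and $\Gamma\vdash\mathrm{match}\,M\,[R_1,\dots,R_k]:B$ if, for some $A$, $\Gamma\vdash M:A$ and each $R_j$ takes $A$ to $B$ in $\Gamma$. Here $\mathrm{all}\,x.R$ (resp. $\mathrm{nab}\,Z.R$) takes $A$ to $B$ in $\Gamma$ if $R$ does in $\Gamma,x{:}D$ for some type $D$ (resp. in $\Gamma,Z{:}D$ for some open $D$), and $p\Longrightarrow M$ does if $p$ has type $A$ in $\Gamma$ and $\Gamma\vdash M:B$. Patterns are typed like the corresponding expressions, with the type of $X$ required to be open in $p@X$, and $\_$ of any type. *Restrictions.* A program is *restricted*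 if every clause in it has the form $\mathrm{all}\,x_1\dots\mathrm{all}\,x_n.\,\mathrm{nab}\,Z_1\dots\mathrm{nab}\,Z_m.(p\Longrightarrow u)$ where: each $x_i$ occurs exactly once in $p$; every occurrence of $\mathrm{pvar}$ and of $@$ in $p$ is in a subpattern $r@X_1\cdots X_j$ ($j\ge0$) with $r$ one of the $x_i$ and $X_1,\dots,X_j$ distinct nominals, each one of the $Z_i$ or bound by a backslash of $p$; pattern variables do not occur under $\mathrm{pnom}$; and each $Z_i$ has a rigid occurrence in $p$, i.e. one that is not in the scope of an $@$. *Evaluation* $E\Downarrow V$ is the least relation with the following rules. Nominals, integers and $\mathrm{lam}\,x.M$ evaluate to themselves; constructor applications, pairs and integer operations are evaluated argumentwise. $\mathrm{new}\,X.E\Downarrow V$ if $E\Downarrow V$ for fresh $X$ not occurring in $V$. $M\,N\Downarrow V$ if $M\Downarrow\mathrm{lam}\,x.R$, $N\Downarrow U$ and $R[U/x]\Downarrow V$. $\mathrm{let}\,x=M\,\mathrm{in}\,R\Downarrow V$ if $M\Downarrow U$ and $R[U/x]\Downarrow V$. $\mathrm{fix}\,x.R\Downarrow V$ if $R[\mathrm{fix}\,x.R/x]\Downarrow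 V$. $M@N\Downarrow V$ if $M\Downarrow X\backslash R$ and $R[N/X]\Downarrow V$. $X\backslash E\Downarrow X\backslash V$ if $E\Downarrow V$ for fresh $X$. $\mathrm{match}\,T\,[R_1,\dots,R_k]$ with $k\ge1$ evaluates to $V$ if either $T$ matches $R_1$ with result $U$ and $U\Downarrow V$, or $T$ matches $R_1$ with no result and $\mathrm{match}\,T\,[R_2,\dots,R_k]\Downarrow V$. (Two versions are considered: $T$ is matched as it stands, or it is first replaced by a value of it.) $T$ matches $\mathrm{all}\,x.R$ with result $U$ if it matches $R[t/x]$ with result $U$ for some term $t$. $T$ matches $\mathrm{nab}\,Z_1\dots\mathrm{nab}\,Z_m.(p\Longrightarrow u)$ with result $U$ if there are a pattern $P$ matched by $T$ and distinct nominals $c_1,\dots,c_m$ such that $\lambda Z_1\dots\lambda Z_m.(p\Longrightarrow u)$ equals $\lambda c_1\dots\lambda c_m.(P\Longrightarrow U)$, the abstraction of the nominals $c_i$ over $P\Longrightarrow U$ (nominal abstraction). A term is matched by a pattern $P$ by structural descent through constructors, pairs, integers and backslashes; $t$ is matched by $\mathrm{pvar}\,t$; a nominal $c$ by $\mathrm{pnom}\,c$;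 any term by $\_$; and $R[c/X]$ by $p@c$, for a nominal $c$, if $X\backslash R$ is matched by $p$. **Claim.** Let $E$ be a restricted program and $A$ a type. If $\vdash E:A$ (in the empty context) and $E\Downarrow V$, in either version of evaluation, then $\vdash V:A$. -/

import Mathlib

namespace MLTS

/-! ### Types and datatype declarations -/

/-- Types over a set `B` of declared (primitive) type names. `bind A C` is `A => C`. -/
inductive Ty (B : Type) : Type
  | int : Ty B
  | base : B → Ty B
  | arrow : Ty B → Ty B → Ty B
  | bind : Ty B → Ty B → Ty B
  | prod : Ty B → Ty B → Ty B

/-- The datatype declarations of a program: type names, the ones declared open, and the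
constructors `C : A₁, …, Aₙ → B`. -/
structure Signature where
  Base : Type
  isOpen : Base → Prop
  Con : Type
  args : Con → List (Ty Base)
  res : Con → Base

/-- The judgment `open A`: only a declared type can be open. -/
inductive OpenTy (S : Signature) : Ty S.Base → Prop
  | base {b : S.Base} : S.isOpen b → OpenTy S (Ty.base b)

/-! ### Abstract syntax -/

/-- Run-time primitives on integers. -/
inductive IntOp : Type
  | add
  | sub
  | mul

def IntOp.denote : IntOp → ℤ → ℤ → ℤ
  | .add => fun a b => a + b
  | .sub => fun a b => a - b
  | .mul => fun a b => a * b

/-- The syntactic categories. -/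
inductive Cat : Type
  | exp
  | exps
  | pat
  | pats
  | rule
  | rules

/-- Abstract syntax, up to `α`-conversion: bound variables are de Bruijn indices. There is no
syntactic distinction between variables and nominals. Each of `lam`, `fix`, `new`, `back`,
`pback`, `all`, `nab` binds one variable in its argument, and `letE M N` binds one in `N`.
A free index stands for a nominal of the ambient context (nothing but a nominal is ever
free during the evaluation of a closed program). The infinitely many indices out of scope serve
as the unused nominals. -/
inductive Syn (S : Signature) : Cat → Type
  | var : ℕ → Syn S .exp
  | lam : Syn S .exp → Syn S .exp
  | app : Syn S .exp → Syn S .exp → Syn S .exp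
  | letE : Syn S .exp → Syn S .exp → Syn S .exp
  | fix : Syn S .exp → Syn S .exp
  | new : Syn S .exp → Syn S .exp
  | back : Syn S .exp → Syn S .exp
  | arob : Syn S .exp → Syn S .exp → Syn S .exp
  | variant : S.Con → Syn S .exps → Syn S .exp
  | pair : Syn S .exp → Syn S .exp → Syn S .exp
  | case : Syn S .exp → Syn S .rules → Syn S .exp
  | int : ℤ → Syn S .exp
  | special : IntOp → Syn S .exp → Syn S .exp → Syn S .exp
  | nil : Syn S .exps
  | cons : Syn S .exp → Syn S .exps → Syn S .exps
  | pvar : Syn S .exp → Syn S .pat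
  | pnom : Syn S .exp → Syn S .pat
  | pvariant : S.Con → Syn S .pats → Syn S .pat
  | ppair : Syn S .pat → Syn S .pat → Syn S .pat
  | pback : Syn S .pat → Syn S .pat
  | parob : Syn S .pat → Syn S .exp → Syn S .pat
  | pint : ℤ → Syn S .pat
  | pwild : Syn S .pat
  | pnil : Syn S .pats
  | pcons : Syn S .pat → Syn S .pats → Syn S .pats
  | all : Syn S .rule → Syn S .rule
  | nab : Syn S .rule → Syn S .rule
  | body : Syn S .pat → Syn S .exp → Syn S .rule
  | rnil : Syn S .rules
  | rcons : Syn S .rule → Syn S .rules → Syn S .rules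

abbrev Exp (S : Signature) := Syn S .exp
abbrev Pat (S : Signature) := Syn S .pat
abbrev Rule (S : Signature) := Syn S .rule

/-- A renaming carried under one binder. -/
def liftRen (f : ℕ → ℕ) : ℕ → ℕ
  | 0 => 0
  | i + 1 => f i + 1

def Syn.rename {S : Signature} : {s : Cat} → (ℕ → ℕ) → Syn S s → Syn S s
  | _, f, .var i => .var (f i)
  | _, f, .lam M => .lam (M.rename (liftRen f))
  | _, f, .app M N => .app (M.rename f) (N.rename f)
  | _, f, .letE M N => .letE (M.rename f) (N.rename (liftRen f))
  | _, f, .fix M => .fix (M.rename (liftRen f))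
  | _, f, .new M => .new (M.rename (liftRen f))
  | _, f, .back M => .back (M.rename (liftRen f))
  | _, f, .arob M N => .arob (M.rename f) (N.rename f)
  | _, f, .variant c Ms => .variant c (Ms.rename f)
  | _, f, .pair M N => .pair (M.rename f) (N.rename f)
  | _, f, .case T Rs => .case (T.rename f) (Rs.rename f)
  | _, _, .int n => .int n
  | _, f, .special o M N => .special o (M.rename f) (N.rename f)
  | _, _, .nil => .nil
  | _, f, .cons M Ms => .cons (M.rename f) (Ms.rename f)
  | _, f, .pvar M => .pvar (M.rename f)
  | _, f, .pnom M => .pnom (M.rename f)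
  | _, f, .pvariant c ps => .pvariant c (ps.rename f)
  | _, f, .ppair p q => .ppair (p.rename f) (q.rename f)
  | _, f, .pback p => .pback (p.rename (liftRen f))
  | _, f, .parob p M => .parob (p.rename f) (M.rename f)
  | _, _, .pint n => .pint n
  | _, _, .pwild => .pwild
  | _, _, .pnil => .pnil
  | _, f, .pcons p ps => .pcons (p.rename f) (ps.rename f)
  | _, f, .all R => .all (R.rename (liftRen f))
  | _, f, .nab R => .nab (R.rename (liftRen f))
  | _, f, .body p u => .body (p.rename f) (u.rename f)
  | _, _, .rnil => .rnil
  | _, f, .rcons R Rs => .rcons (R.rename f) (Rs.rename f)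

/-- Weakening: the same phrase in the scope of one more binder, which it does not use. -/
def Syn.shift {S : Signature} {s : Cat} (M : Syn S s) : Syn S s := M.rename Nat.succ

/-- A substitution carried under one binder. -/
def liftSub {S : Signature} (σ : ℕ → Exp S) : ℕ → Exp S
  | 0 => .var 0
  | i + 1 => (σ i).shift

/-- Capture-avoiding simultaneous substitution. -/
def Syn.subst {S : Signature} : {s : Cat} → (ℕ → Exp S) → Syn S s → Syn S s
  | _, σ, .var i => σ i
  | _, σ, .lam M => .lam (M.subst (liftSub σ))
  | _, σ, .app M N => .app (M.subst σ) (N.subst σ)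
  | _, σ, .letE M N => .letE (M.subst σ) (N.subst (liftSub σ))
  | _, σ, .fix M => .fix (M.subst (liftSub σ))
  | _, σ, .new M => .new (M.subst (liftSub σ))
  | _, σ, .back M => .back (M.subst (liftSub σ))
  | _, σ, .arob M N => .arob (M.subst σ) (N.subst σ)
  | _, σ, .variant c Ms => .variant c (Ms.subst σ)
  | _, σ, .pair M N => .pair (M.subst σ) (N.subst σ)
  | _, σ, .case T Rs => .case (T.subst σ) (Rs.subst σ)
  | _, _, .int n => .int n
  | _, σ, .special o M N => .special o (M.subst σ) (N.subst σ)
  | _, _, .nil => .nil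
  | _, σ, .cons M Ms => .cons (M.subst σ) (Ms.subst σ)
  | _, σ, .pvar M => .pvar (M.subst σ)
  | _, σ, .pnom M => .pnom (M.subst σ)
  | _, σ, .pvariant c ps => .pvariant c (ps.subst σ)
  | _, σ, .ppair p q => .ppair (p.subst σ) (q.subst σ)
  | _, σ, .pback p => .pback (p.subst (liftSub σ))
  | _, σ, .parob p M => .parob (p.subst σ) (M.subst σ)
  | _, _, .pint n => .pint n
  | _, _, .pwild => .pwild
  | _, _, .pnil => .pnil
  | _, σ, .pcons p ps => .pcons (p.subst σ) (ps.subst σ)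
  | _, σ, .all R => .all (R.subst (liftSub σ))
  | _, σ, .nab R => .nab (R.subst (liftSub σ))
  | _, σ, .body p u => .body (p.subst σ) (u.subst σ)
  | _, _, .rnil => .rnil
  | _, σ, .rcons R Rs => .rcons (R.subst σ) (Rs.subst σ)

def instSub {S : Signature} (N : Exp S) : ℕ → Exp S
  | 0 => N
  | i + 1 => .var i

/-- `R.inst N` is the application `(R N)` of the abstraction with body `R`, after
`β`-reduction. -/
def Syn.inst {S : Signature} {s : Cat} (R : Syn S s) (N : Exp S) : Syn S s :=
  R.subst (instSub N)

/-- `all x₁ … all xₙ. R` -/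
def alls {S : Signature} : ℕ → Rule S → Rule S
  | 0, R => R
  | n + 1, R => .all (alls n R)

/-- `nab Z₁ … nab Zₘ. R` -/
def nabs {S : Signature} : ℕ → Rule S → Rule S
  | 0, R => R
  | m + 1, R => .nab (nabs m R)

/-! ### Typing -/

/-- The typing judgments: `M : A`, its pointwise extension to lists, patterns `p : A`, its
pointwise extension, and clauses `A : R : B` (scrutinee type `A`, result type `B`). -/
inductive Judgment (S : Signature) : Type
  | exp : Exp S → Ty S.Base → Judgment S
  | exps : Syn S .exps → List (Ty S.Base) → Judgment S
  | pat : Pat S → Ty S.Base → Judgment S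
  | pats : Syn S .pats → List (Ty S.Base) → Judgment S
  | rule : Ty S.Base → Rule S → Ty S.Base → Judgment S
  | rules : Ty S.Base → Syn S .rules → Ty S.Base → Judgment S

/-- Derivability of a typing judgment in a context `Γ`, where `Γ[i]` is the type of the variable
or nominal with index `i`. The pattern variables of a clause are explicitly bound by `all` here,
so the context `Δ` of types that a pattern assigns to its variables enters `Γ` at `all`. -/
inductive Derives (S : Signature) : List (Ty S.Base) → Judgment S → Prop
  | var {Γ i A} : Γ[i]? = some A → Derives S Γ (.exp (.var i) A)
  | app {Γ M N A B} : Derives S Γ (.exp M (.arrow A B)) → Derives S Γ (.exp N A) →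
      Derives S Γ (.exp (.app M N) B)
  | lam {Γ M A B} : Derives S (A :: Γ) (.exp M B) → Derives S Γ (.exp (.lam M) (.arrow A B))
  | letE {Γ M N A B} : Derives S Γ (.exp M A) → Derives S (A :: Γ) (.exp N B) →
      Derives S Γ (.exp (.letE M N) B)
  | fix {Γ M A} : Derives S (A :: Γ) (.exp M A) → Derives S Γ (.exp (.fix M) A)
  | back {Γ M A B} : Derives S (A :: Γ) (.exp M B) → OpenTy S A →
      Derives S Γ (.exp (.back M) (.bind A B))
  | arob {Γ M N A B} : Derives S Γ (.exp M (.bind A B)) → Derives S Γ (.exp N A) →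
      Derives S Γ (.exp (.arob M N) B)
  | variant {Γ c Ms} : Derives S Γ (.exps Ms (S.args c)) →
      Derives S Γ (.exp (.variant c Ms) (.base (S.res c)))
  | pair {Γ M N A B} : Derives S Γ (.exp M A) → Derives S Γ (.exp N B) →
      Derives S Γ (.exp (.pair M N) (.prod A B))
  | new {Γ M A B} : Derives S (A :: Γ) (.exp M B) → OpenTy S A →
      Derives S Γ (.exp (.new M) B)
  | case {Γ T Rs A B} : Derives S Γ (.exp T B) → Derives S Γ (.rules B Rs A) →
      Derives S Γ (.exp (.case T Rs) A)
  | int {Γ n} : Derives S Γ (.exp (.int n) .int)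
  | special {Γ o M N} : Derives S Γ (.exp M .int) → Derives S Γ (.exp N .int) →
      Derives S Γ (.exp (.special o M N) .int)
  | nil {Γ} : Derives S Γ (.exps .nil [])
  | cons {Γ M Ms A As} : Derives S Γ (.exp M A) → Derives S Γ (.exps Ms As) →
      Derives S Γ (.exps (.cons M Ms) (A :: As))
  | rnil {Γ A B} : Derives S Γ (.rules A .rnil B)
  | rcons {Γ R Rs A B} : Derives S Γ (.rule A R B) → Derives S Γ (.rules A Rs B) →
      Derives S Γ (.rules A (.rcons R Rs) B)
  | all {Γ R A B C} : Derives S (C :: Γ) (.rule A R B) → Derives S Γ (.rule A (.all R) B)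
  | nab {Γ R A B C} : Derives S (C :: Γ) (.rule A R B) → OpenTy S C →
      Derives S Γ (.rule A (.nab R) B)
  | body {Γ p u A B} : Derives S Γ (.pat p A) → Derives S Γ (.exp u B) →
      Derives S Γ (.rule A (.body p u) B)
  | pvar {Γ M A} : Derives S Γ (.exp M A) → Derives S Γ (.pat (.pvar M) A)
  | pnom {Γ M A} : Derives S Γ (.exp M A) → Derives S Γ (.pat (.pnom M) A)
  | parob {Γ p M A B} : Derives S Γ (.pat p (.bind A B)) → Derives S Γ (.exp M A) →
      OpenTy S A → Derives S Γ (.pat (.parob p M) B)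
  | pback {Γ p A B} : Derives S (A :: Γ) (.pat p B) → OpenTy S A →
      Derives S Γ (.pat (.pback p) (.bind A B))
  | ppair {Γ p q A B} : Derives S Γ (.pat p A) → Derives S Γ (.pat q B) →
      Derives S Γ (.pat (.ppair p q) (.prod A B))
  | pvariant {Γ c ps} : Derives S Γ (.pats ps (S.args c)) →
      Derives S Γ (.pat (.pvariant c ps) (.base (S.res c)))
  | pint {Γ n} : Derives S Γ (.pat (.pint n) .int)
  | pwild {Γ A} : Derives S Γ (.pat .pwild A)
  | pnil {Γ} : Derives S Γ (.pats .pnil [])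
  | pcons {Γ p ps A As} : Derives S Γ (.pat p A) → Derives S Γ (.pats ps As) →
      Derives S Γ (.pats (.pcons p ps) (A :: As))

/-- `Γ ⊢ M : A` -/
def HasType {S : Signature} (Γ : List (Ty S.Base)) (M : Exp S) (A : Ty S.Base) : Prop :=
  Derives S Γ (.exp M A)

/-! ### Restrictions on match clauses

Inside the pattern of a clause `all x₁ … all xₙ. nab Z₁ … nab Zₘ. (p ==> u)`, below `k`
backslashes of `p`, the indices `< b = m + k` are the nominals bound in the scope of the pattern
variables, the indices in `[b, b + n)` are the pattern variables and those `≥ b + n` are ambient. -/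

/-- `(r @ X₁ … Xⱼ)`, `j ≥ 0`, with `r` a pattern variable and `X₁, …, Xⱼ` distinct nominals bound
in the scope of `r`; the list collects the `Xᵢ`. -/
inductive Flex {S : Signature} (b n : ℕ) : Pat S → List ℕ → Prop
  | pvar {i : ℕ} : b ≤ i → i < b + n → Flex b n (.pvar (.var i)) []
  | parob {p : Pat S} {xs : List ℕ} {i : ℕ} : Flex b n p xs → i < b → i ∉ xs →
      Flex b n (.parob p (.var i)) (i :: xs)

/-- Higher-order pattern restriction. A nominal occurring in a pattern outside of `@` is local to
the clause or ambient (an ambient nominal may have been replaced by a term through `@`). -/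
inductive PatScoped {S : Signature} (n : ℕ) : ℕ → {s : Cat} → Syn S s → Prop
  | flex {b : ℕ} {p : Pat S} {xs : List ℕ} : Flex b n p xs → PatScoped n b p
  | localNom {b i : ℕ} : i < b → PatScoped n b (.pnom (.var i))
  | ambientNom {b : ℕ} {M N : Exp S} : M = N.rename (fun i => i + (b + n)) →
      PatScoped n b (.pnom M)
  | pvariant {b : ℕ} {c : S.Con} {ps : Syn S .pats} : PatScoped n b ps →
      PatScoped n b (.pvariant c ps)
  | ppair {b : ℕ} {p q : Pat S} : PatScoped n b p → PatScoped n b q → PatScoped n b (.ppair p q)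
  | pback {b : ℕ} {p : Pat S} : PatScoped n (b + 1) p → PatScoped n b (.pback p)
  | pint {b : ℕ} {k : ℤ} : PatScoped n b (.pint k)
  | pwild {b : ℕ} : PatScoped n b .pwild
  | pnil {b : ℕ} : PatScoped n b .pnil
  | pcons {b : ℕ} {p : Pat S} {ps : Syn S .pats} : PatScoped n b p → PatScoped n b ps →
      PatScoped n b (.pcons p ps)

def Syn.isVar {S : Signature} : {s : Cat} → ℕ → Syn S s → ℕ
  | _, i, .var j => if i = j then 1 else 0
  | _, _, _ => 0

/-- The number of occurrences of the pattern variable `i` in a pattern. -/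
def Syn.occ {S : Signature} : {s : Cat} → ℕ → Syn S s → ℕ
  | _, i, .pvar M => M.isVar i
  | _, i, .pvariant _ ps => ps.occ i
  | _, i, .ppair p q => p.occ i + q.occ i
  | _, i, .pback p => p.occ (i + 1)
  | _, i, .parob p _ => p.occ i
  | _, i, .pcons p ps => p.occ i + ps.occ i
  | _, _, _ => 0

/-- The nominal `i` has a rigid occurrence (one outside of the scope of `@`) in a pattern. -/
inductive Rigid {S : Signature} : ℕ → {s : Cat} → Syn S s → Prop
  | pnom {i : ℕ} : Rigid i (.pnom (.var i))
  | pvariant {i : ℕ} {c : S.Con} {ps : Syn S .pats} : Rigid i ps → Rigid i (.pvariant c ps)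
  | ppairLeft {i : ℕ} {p q : Pat S} : Rigid i p → Rigid i (.ppair p q)
  | ppairRight {i : ℕ} {p q : Pat S} : Rigid i q → Rigid i (.ppair p q)
  | pback {i : ℕ} {p : Pat S} : Rigid (i + 1) p → Rigid i (.pback p)
  | pconsHead {i : ℕ} {p : Pat S} {ps : Syn S .pats} : Rigid i p → Rigid i (.pcons p ps)
  | pconsTail {i : ℕ} {p : Pat S} {ps : Syn S .pats} : Rigid i ps → Rigid i (.pcons p ps)

/-- The restrictions on one clause: it has a `∀∇` prefix, its pattern is a higher-order pattern,
each pattern variable occurs exactly once in it and each `nab`-bound nominal occurs rigidly. -/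
def ClauseOK {S : Signature} (R : Rule S) : Prop :=
  ∃ (n m : ℕ) (p : Pat S) (u : Exp S), R = alls n (nabs m (.body p u)) ∧
    PatScoped n m p ∧ (∀ i, m ≤ i → i < m + n → p.occ i = 1) ∧ ∀ i, i < m → Rigid i p

/-- All clauses occurring anywhere in a phrase satisfy the restrictions. -/
def Syn.Restricted {S : Signature} : {s : Cat} → Syn S s → Prop
  | _, .var _ => True
  | _, .lam M => M.Restricted
  | _, .app M N => M.Restricted ∧ N.Restricted
  | _, .letE M N => M.Restricted ∧ N.Restricted
  | _, .fix M => M.Restricted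
  | _, .new M => M.Restricted
  | _, .back M => M.Restricted
  | _, .arob M N => M.Restricted ∧ N.Restricted
  | _, .variant _ Ms => Ms.Restricted
  | _, .pair M N => M.Restricted ∧ N.Restricted
  | _, .case T Rs => T.Restricted ∧ Rs.Restricted
  | _, .int _ => True
  | _, .special _ M N => M.Restricted ∧ N.Restricted
  | _, .nil => True
  | _, .cons M Ms => M.Restricted ∧ Ms.Restricted
  | _, .pvar M => M.Restricted
  | _, .pnom M => M.Restricted
  | _, .pvariant _ ps => ps.Restricted
  | _, .ppair p q => p.Restricted ∧ q.Restricted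
  | _, .pback p => p.Restricted
  | _, .parob p M => p.Restricted ∧ M.Restricted
  | _, .pint _ => True
  | _, .pwild => True
  | _, .pnil => True
  | _, .pcons p ps => p.Restricted ∧ ps.Restricted
  | _, .all R => R.Restricted
  | _, .nab R => R.Restricted
  | _, .body p u => p.Restricted ∧ u.Restricted
  | _, .rnil => True
  | _, .rcons R Rs => ClauseOK R ∧ R.Restricted ∧ Rs.Restricted

/-! ### Natural semantics -/

/-- The renaming that turns `t` into the body of `λ c₁ … λ cₘ. t`: the nominals in the list (the
innermost abstraction first) become the bound variables, the others are weakened. -/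
def absVar (cs : List ℕ) (v : ℕ) : ℕ :=
  if v ∈ cs then cs.idxOf v else v + cs.length

/-- The nominal abstraction `(λ Z₁ … λ Zₘ. s) ⊵ t` of degree `m`: the left-hand side is
`λ c₁ … λ cₘ. t` for some distinct nominals `c₁, …, cₘ`. -/
def NominalAbstraction {S : Signature} {k : Cat} (m : ℕ) (s t : Syn S k) : Prop :=
  ∃ cs : List ℕ, cs.length = m ∧ cs.Nodup ∧ s = t.rename (absVar cs)

/-- A term (or list of terms) is matched by a pattern whose variables are already instantiated.
The rule for `pback` is a `∇` over the bound nominal. The last rule says that `R X` is matched by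
`p @ X` if `X \ R X` is matched by `p`. -/
inductive Matches {S : Signature} : {s s' : Cat} → Syn S s → Syn S s' → Prop
  | variant {c : S.Con} {Ts : Syn S .exps} {ps : Syn S .pats} : Matches Ts ps →
      Matches (.variant c Ts) (.pvariant c ps)
  | nil : Matches .nil .pnil
  | cons {T : Exp S} {Ts : Syn S .exps} {p : Pat S} {ps : Syn S .pats} : Matches T p →
      Matches Ts ps → Matches (.cons T Ts) (.pcons p ps)
  | pair {T T' : Exp S} {p q : Pat S} : Matches T p → Matches T' q →
      Matches (.pair T T') (.ppair p q)
  | int {n : ℤ} : Matches (.int n) (.pint n)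
  | wild {T : Exp S} : Matches T .pwild
  | nom {c : ℕ} : Matches (.var c) (.pnom (.var c))
  | pvar {T : Exp S} : Matches T (.pvar T)
  | back {T : Exp S} {p : Pat S} : Matches T p → Matches (.back T) (.pback p)
  | arob {T R : Exp S} {p : Pat S} {c : ℕ} : T = R.inst (.var c) → Matches (.back R) p →
      Matches T (.parob p (.var c))

/-- `Clause T R U`: the term `T` matches the clause `R`, and `U` is the resulting instance of its
right-hand side. -/
inductive Clause {S : Signature} (T : Exp S) : Rule S → Exp S → Prop
  | all {R : Rule S} {U : Exp S} (x : Exp S) : Clause T (R.inst x) U → Clause T (.all R) U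
  | nabs {m : ℕ} {p P : Pat S} {u U : Exp S} : Matches T P →
      NominalAbstraction m (.body p u) (.body P U) → Clause T (nabs m (.body p u)) U

/-- Whether a match expression matches its scrutinee as it stands, or its value. -/
inductive Scrutinee : Type
  | asIs
  | evaluated

/-- Big-step evaluation `E ⇓ V`, on expressions and pointwise on lists. In the rules for `new` and
`back` the premise is a `∇` over the bound nominal; for `new` its value does not contain it. -/
inductive Eval {S : Signature} : Scrutinee → {s : Cat} → Syn S s → Syn S s → Prop
  | nom {σ : Scrutinee} {X : ℕ} : Eval σ (.var X) (.var X)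
  | lam {σ : Scrutinee} {R : Exp S} : Eval σ (.lam R) (.lam R)
  | variant {σ : Scrutinee} {c : S.Con} {Ts Vs : Syn S .exps} : Eval σ Ts Vs →
      Eval σ (.variant c Ts) (.variant c Vs)
  | nil {σ : Scrutinee} : Eval σ .nil .nil
  | cons {σ : Scrutinee} {T V : Exp S} {Ts Vs : Syn S .exps} : Eval σ T V → Eval σ Ts Vs →
      Eval σ (.cons T Ts) (.cons V Vs)
  | pair {σ : Scrutinee} {M N V W : Exp S} : Eval σ M V → Eval σ N W →
      Eval σ (.pair M N) (.pair V W)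
  | int {σ : Scrutinee} {n : ℤ} : Eval σ (.int n) (.int n)
  | special {σ : Scrutinee} {o : IntOp} {M N : Exp S} {a b : ℤ} : Eval σ M (.int a) →
      Eval σ N (.int b) → Eval σ (.special o M N) (.int (o.denote a b))
  | new {σ : Scrutinee} {E V : Exp S} : Eval σ E V.shift → Eval σ (.new E) V
  | app {σ : Scrutinee} {M N R U V : Exp S} : Eval σ M (.lam R) → Eval σ N U →
      Eval σ (R.inst U) V → Eval σ (.app M N) V
  | letE {σ : Scrutinee} {M R U V : Exp S} : Eval σ M U → Eval σ (R.inst U) V →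
      Eval σ (.letE M R) V
  | fix {σ : Scrutinee} {R V : Exp S} : Eval σ (R.inst (.fix R)) V → Eval σ (.fix R) V
  | arob {σ : Scrutinee} {M N R V : Exp S} : Eval σ M (.back R) → Eval σ (R.inst N) V →
      Eval σ (.arob M N) V
  | back {σ : Scrutinee} {E V : Exp S} : Eval σ E V → Eval σ (.back E) (.back V)
  | hit {T U V : Exp S} {R : Rule S} {Rs : Syn S .rules} : Clause T R U → Eval .asIs U V →
      Eval .asIs (.case T (.rcons R Rs)) V
  | skip {T V : Exp S} {R : Rule S} {Rs : Syn S .rules} : (¬ ∃ U, Clause T R U) →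
      Eval .asIs (.case T Rs) V → Eval .asIs (.case T (.rcons R Rs)) V
  | hitEval {T W U V : Exp S} {R : Rule S} {Rs : Syn S .rules} : Eval .evaluated T W →
      Clause W R U → Eval .evaluated U V → Eval .evaluated (.case T (.rcons R Rs)) V
  | skipEval {T W V : Exp S} {R : Rule S} {Rs : Syn S .rules} : Eval .evaluated T W →
      (¬ ∃ U, Clause W R U) → Eval .evaluated (.case W Rs) V →
      Eval .evaluated (.case T (.rcons R Rs)) V

end MLTS

namespace MLTS

variable {S : Signature}

/-! ### Renaming and substitution -/

/-! Preservation is proved by induction on evaluation, in an arbitrary context, together with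
preservation of the clause restrictions: the clauses met at run time are substitution instances of
source clauses. Outside `match`, inversion of typing and the substitution lemma suffice.

The content is `Clause.preservation`. Let the `all`-variables be instantiated by `τ` and the
`nab`-variables by nominals `cs`. Renaming each `cᵢ` to the bound variable `Zᵢ` makes the scrutinee
match `p` under `τ`, in the context `nominalTypes Γ cs ++ Γ`. Two facts must be recovered, since
matching guesses both `τ` and `cs` untyped. A rigid occurrence of `Zᵢ` in `p` is met by the same
nominal in the scrutinee, which forces the declared type of `Zᵢ` to be that of `cᵢ`
(`Rigid.type_eq`). A pattern variable occurs as `x @ X₁ … Xⱼ`. Its instance lies outside the scope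
of the local nominals, so it cannot mention them; hence it is a `j`-fold backslash whose body is, up
to an injective renaming, the matched subterm, and its type is read off that subterm
(`Flex.solution`, `PatScoped.solution`). So `τ` is well typed, the right-hand side is typed by
substitution, and its type is pulled back along the renaming (`HasType.of_rename`). -/

theorem liftRen_comp (f g : ℕ → ℕ) : liftRen g ∘ liftRen f = liftRen (g ∘ f) := by
  funext i; cases i <;> rfl

theorem Syn.rename_rename {s : Cat} (M : Syn S s) :
    ∀ f g : ℕ → ℕ, (M.rename f).rename g = M.rename (g ∘ f) := by
  induction M <;> intro f g <;> simp_all [Syn.rename, liftRen_comp]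

theorem liftRen_id : liftRen id = id := by
  funext i; cases i <;> rfl

theorem Syn.rename_id {s : Cat} (M : Syn S s) : M.rename id = M := by
  induction M <;> simp_all [Syn.rename, liftRen_id]

theorem liftSub_var_comp (f : ℕ → ℕ) :
    liftSub (fun i => (Syn.var (f i) : Exp S)) = fun i => .var (liftRen f i) := by
  funext i; cases i <;> rfl

theorem Syn.rename_eq_subst {s : Cat} (M : Syn S s) :
    ∀ f : ℕ → ℕ, M.rename f = M.subst (fun i => .var (f i)) := by
  induction M <;> intro f <;> simp_all [Syn.rename, Syn.subst, liftSub_var_comp]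

theorem liftSub_comp_liftRen (f : ℕ → ℕ) (σ : ℕ → Exp S) :
    liftSub σ ∘ liftRen f = liftSub (σ ∘ f) := by
  funext i; cases i <;> rfl

theorem Syn.subst_rename {s : Cat} (M : Syn S s) :
    ∀ (f : ℕ → ℕ) (σ : ℕ → Exp S), (M.rename f).subst σ = M.subst (σ ∘ f) := by
  induction M <;> intro f σ <;> simp_all [Syn.rename, Syn.subst, liftSub_comp_liftRen]

theorem rename_liftSub (f : ℕ → ℕ) (σ : ℕ → Exp S) :
    (fun i => (liftSub σ i).rename (liftRen f)) = liftSub (fun i => (σ i).rename f) := by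
  funext i
  cases i with
  | zero => rfl
  | succ i =>
    simp only [liftSub, Syn.shift, Syn.rename_rename]
    rfl

theorem Syn.rename_subst {s : Cat} (M : Syn S s) :
    ∀ (f : ℕ → ℕ) (σ : ℕ → Exp S),
      (M.subst σ).rename f = M.subst (fun i => (σ i).rename f) := by
  induction M <;> intro f σ <;> simp_all [Syn.rename, Syn.subst, rename_liftSub]

theorem subst_liftSub (σ τ : ℕ → Exp S) :
    (fun i => (liftSub σ i).subst (liftSub τ)) = liftSub (fun i => (σ i).subst τ) := by
  funext i
  cases i with
  | zero => rfl
  | succ i =>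
    simp only [liftSub, Syn.shift, Syn.subst_rename, Syn.rename_subst]
    rfl

theorem Syn.subst_subst {s : Cat} (M : Syn S s) :
    ∀ σ τ : ℕ → Exp S, (M.subst σ).subst τ = M.subst (fun i => (σ i).subst τ) := by
  induction M <;> intro σ τ <;> simp_all [Syn.subst, subst_liftSub]

theorem Syn.subst_var {s : Cat} (M : Syn S s) : M.subst Syn.var = M := by
  conv_rhs => rw [← M.rename_id, Syn.rename_eq_subst]
  rfl

/-- Instantiating with a nominal is a renaming. -/
def instRen (c : ℕ) : ℕ → ℕ
  | 0 => c
  | i + 1 => i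

theorem Syn.inst_var {s : Cat} (M : Syn S s) (c : ℕ) :
    M.inst (.var c) = M.rename (instRen c) := by
  rw [Syn.inst, Syn.rename_eq_subst]
  congr 1
  funext i; cases i <;> rfl

theorem Syn.inst_liftSub {s : Cat} (M : Syn S s) (σ : ℕ → Exp S) (N : Exp S) :
    (M.subst (liftSub σ)).inst N = M.subst (fun i => Nat.casesOn i N σ) := by
  rw [Syn.inst, Syn.subst_subst]
  congr 1
  funext i
  cases i with
  | zero => rfl
  | succ i =>
    simp only [liftSub, Syn.shift, Syn.subst_rename]
    exact Syn.subst_var _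

theorem Syn.rename_inst_var {s : Cat} (M : Syn S s) (c : ℕ) (f : ℕ → ℕ) :
    (M.inst (.var c)).rename f = (M.rename (liftRen f)).inst (.var (f c)) := by
  simp only [Syn.inst_var, Syn.rename_rename]
  congr 1
  funext i; cases i <;> rfl

theorem Syn.rename_invFun {s : Cat} {f : ℕ → ℕ} (hf : f.Injective) (M : Syn S s) :
    (M.rename f).rename (Function.invFun f) = M := by
  rw [Syn.rename_rename, Function.invFun_comp hf, Syn.rename_id]

/-! ### Substitutions carried under several binders -/

theorem liftSub_iterate_of_lt (σ : ℕ → Exp S) {b i : ℕ} (h : i < b) :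
    liftSub^[b] σ i = .var i := by
  induction b generalizing i with
  | zero => omega
  | succ b ih =>
    rw [Function.iterate_succ_apply']
    cases i with
    | zero => rfl
    | succ i =>
      rw [liftSub, ih (by omega)]
      rfl

/-- This is the scoping fact behind matching: a term substituted below `b` binders is weakened by
`b`, so it mentions none of the `b` local variables. -/
theorem liftSub_iterate_add (σ : ℕ → Exp S) (b k : ℕ) :
    liftSub^[b] σ (k + b) = (σ k).rename (fun i => i + b) := by
  induction b with
  | zero => exact (Syn.rename_id _).symm
  | succ b ih =>
    rw [Function.iterate_succ_apply', ← Nat.add_assoc, liftSub, ih, Syn.shift, Syn.rename_rename]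
    rfl

theorem alls_subst (n : ℕ) (R : Rule S) (σ : ℕ → Exp S) :
    (alls n R).subst σ = alls n (R.subst (liftSub^[n] σ)) := by
  induction n generalizing σ with
  | zero => rfl
  | succ n ih => simp [alls, Syn.subst, ih]

theorem nabs_subst (n : ℕ) (R : Rule S) (σ : ℕ → Exp S) :
    (nabs n R).subst σ = nabs n (R.subst (liftSub^[n] σ)) := by
  induction n generalizing σ with
  | zero => rfl
  | succ n ih => simp [nabs, Syn.subst, ih]

/-! ### Typing under renaming and substitution -/

def Judgment.rename (f : ℕ → ℕ) : Judgment S → Judgment S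
  | .exp M A => .exp (M.rename f) A
  | .exps Ms As => .exps (Ms.rename f) As
  | .pat p A => .pat (p.rename f) A
  | .pats ps As => .pats (ps.rename f) As
  | .rule A R B => .rule A (R.rename f) B
  | .rules A Rs B => .rules A (Rs.rename f) B

def Judgment.subst (σ : ℕ → Exp S) : Judgment S → Judgment S
  | .exp M A => .exp (M.subst σ) A
  | .exps Ms As => .exps (Ms.subst σ) As
  | .pat p A => .pat (p.subst σ) A
  | .pats ps As => .pats (ps.subst σ) As
  | .rule A R B => .rule A (R.subst σ) B
  | .rules A Rs B => .rules A (Rs.subst σ) B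

/-- The renaming `f` maps the context `Γ` to `Δ`. -/
def RenTyped (f : ℕ → ℕ) (Γ Δ : List (Ty S.Base)) : Prop :=
  ∀ i A, Γ[i]? = some A → Δ[f i]? = some A

/-- The renaming `f` pulls the context `Γ` back to `Δ`. -/
def RenReflects (f : ℕ → ℕ) (Γ Δ : List (Ty S.Base)) : Prop :=
  ∀ i A, Γ[f i]? = some A → Δ[i]? = some A

def SubTyped (σ : ℕ → Exp S) (Γ Δ : List (Ty S.Base)) : Prop :=
  ∀ i A, Γ[i]? = some A → HasType Δ (σ i) A

theorem RenTyped.lift {f : ℕ → ℕ} {Γ Δ : List (Ty S.Base)} (h : RenTyped f Γ Δ)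
    (B : Ty S.Base) : RenTyped (liftRen f) (B :: Γ) (B :: Δ) := by
  rintro (_ | i) A hi
  · exact hi
  · exact h i A hi

theorem RenReflects.lift {f : ℕ → ℕ} {Γ Δ : List (Ty S.Base)} (h : RenReflects f Γ Δ)
    (B : Ty S.Base) : RenReflects (liftRen f) (B :: Γ) (B :: Δ) := by
  rintro (_ | i) A hi
  · exact hi
  · exact h i A hi

theorem Derives.rename {Γ : List (Ty S.Base)} {J : Judgment S} (h : Derives S Γ J) :
    ∀ {f : ℕ → ℕ} {Δ : List (Ty S.Base)}, RenTyped f Γ Δ → Derives S Δ (J.rename f) := by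
  induction h with
  | var h => exact fun hf => .var (hf _ _ h)
  | app _ _ h₁ h₂ => exact fun hf => .app (h₁ hf) (h₂ hf)
  | lam _ h => exact fun hf => .lam (h (hf.lift _))
  | letE _ _ h₁ h₂ => exact fun hf => .letE (h₁ hf) (h₂ (hf.lift _))
  | fix _ h => exact fun hf => .fix (h (hf.lift _))
  | back _ o h => exact fun hf => .back (h (hf.lift _)) o
  | arob _ _ h₁ h₂ => exact fun hf => .arob (h₁ hf) (h₂ hf)
  | variant _ h => exact fun hf => .variant (h hf)
  | pair _ _ h₁ h₂ => exact fun hf => .pair (h₁ hf) (h₂ hf)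
  | new _ o h => exact fun hf => .new (h (hf.lift _)) o
  | case _ _ h₁ h₂ => exact fun hf => .case (h₁ hf) (h₂ hf)
  | int => exact fun _ => .int
  | special _ _ h₁ h₂ => exact fun hf => .special (h₁ hf) (h₂ hf)
  | nil => exact fun _ => .nil
  | cons _ _ h₁ h₂ => exact fun hf => .cons (h₁ hf) (h₂ hf)
  | rnil => exact fun _ => .rnil
  | rcons _ _ h₁ h₂ => exact fun hf => .rcons (h₁ hf) (h₂ hf)
  | all _ h => exact fun hf => .all (h (hf.lift _))
  | nab _ o h => exact fun hf => .nab (h (hf.lift _)) o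
  | body _ _ h₁ h₂ => exact fun hf => .body (h₁ hf) (h₂ hf)
  | pvar _ h => exact fun hf => .pvar (h hf)
  | pnom _ h => exact fun hf => .pnom (h hf)
  | parob _ _ o h₁ h₂ => exact fun hf => .parob (h₁ hf) (h₂ hf) o
  | pback _ o h => exact fun hf => .pback (h (hf.lift _)) o
  | ppair _ _ h₁ h₂ => exact fun hf => .ppair (h₁ hf) (h₂ hf)
  | pvariant _ h => exact fun hf => .pvariant (h hf)
  | pint => exact fun _ => .pint
  | pwild => exact fun _ => .pwild
  | pnil => exact fun _ => .pnil
  | pcons _ _ h₁ h₂ => exact fun hf => .pcons (h₁ hf) (h₂ hf)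

theorem SubTyped.lift {σ : ℕ → Exp S} {Γ Δ : List (Ty S.Base)} (h : SubTyped σ Γ Δ)
    (B : Ty S.Base) : SubTyped (liftSub σ) (B :: Γ) (B :: Δ) := by
  rintro (_ | i) A hi
  · exact .var hi
  · exact Derives.rename (h i A hi) fun _ _ hj => hj

theorem Derives.subst {Γ : List (Ty S.Base)} {J : Judgment S} (h : Derives S Γ J) :
    ∀ {σ : ℕ → Exp S} {Δ : List (Ty S.Base)}, SubTyped σ Γ Δ → Derives S Δ (J.subst σ) := by
  induction h with
  | var h => exact fun hf => hf _ _ h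
  | app _ _ h₁ h₂ => exact fun hf => .app (h₁ hf) (h₂ hf)
  | lam _ h => exact fun hf => .lam (h (hf.lift _))
  | letE _ _ h₁ h₂ => exact fun hf => .letE (h₁ hf) (h₂ (hf.lift _))
  | fix _ h => exact fun hf => .fix (h (hf.lift _))
  | back _ o h => exact fun hf => .back (h (hf.lift _)) o
  | arob _ _ h₁ h₂ => exact fun hf => .arob (h₁ hf) (h₂ hf)
  | variant _ h => exact fun hf => .variant (h hf)
  | pair _ _ h₁ h₂ => exact fun hf => .pair (h₁ hf) (h₂ hf)
  | new _ o h => exact fun hf => .new (h (hf.lift _)) o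
  | case _ _ h₁ h₂ => exact fun hf => .case (h₁ hf) (h₂ hf)
  | int => exact fun _ => .int
  | special _ _ h₁ h₂ => exact fun hf => .special (h₁ hf) (h₂ hf)
  | nil => exact fun _ => .nil
  | cons _ _ h₁ h₂ => exact fun hf => .cons (h₁ hf) (h₂ hf)
  | rnil => exact fun _ => .rnil
  | rcons _ _ h₁ h₂ => exact fun hf => .rcons (h₁ hf) (h₂ hf)
  | all _ h => exact fun hf => .all (h (hf.lift _))
  | nab _ o h => exact fun hf => .nab (h (hf.lift _)) o
  | body _ _ h₁ h₂ => exact fun hf => .body (h₁ hf) (h₂ hf)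
  | pvar _ h => exact fun hf => .pvar (h hf)
  | pnom _ h => exact fun hf => .pnom (h hf)
  | parob _ _ o h₁ h₂ => exact fun hf => .parob (h₁ hf) (h₂ hf) o
  | pback _ o h => exact fun hf => .pback (h (hf.lift _)) o
  | ppair _ _ h₁ h₂ => exact fun hf => .ppair (h₁ hf) (h₂ hf)
  | pvariant _ h => exact fun hf => .pvariant (h hf)
  | pint => exact fun _ => .pint
  | pwild => exact fun _ => .pwild
  | pnil => exact fun _ => .pnil
  | pcons _ _ h₁ h₂ => exact fun hf => .pcons (h₁ hf) (h₂ hf)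

theorem HasType.inst {Γ : List (Ty S.Base)} {M N : Exp S} {A B : Ty S.Base}
    (hM : HasType (A :: Γ) M B) (hN : HasType Γ N A) : HasType Γ (M.inst N) B := by
  refine Derives.subst hM ?_
  rintro (_ | i) C hi
  · cases hi; exact hN
  · exact .var hi

/-- The judgments about a phrase, given by their types. -/
inductive Judgment.About : Judgment S → {s : Cat} → Syn S s → Prop
  | exp {M : Exp S} {A} : About (.exp M A) M
  | exps {M : Syn S .exps} {A} : About (.exps M A) M
  | pat {M : Pat S} {A} : About (.pat M A) M
  | pats {M : Syn S .pats} {A} : About (.pats M A) M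
  | rule {A} {M : Rule S} {B} : About (.rule A M B) M
  | rules {A} {M : Syn S .rules} {B} : About (.rules A M B) M

/-- Renaming preserves the shape of a phrase, so a derivation can be replayed on the original one;
only the variable rule consults the context. The induction is on the phrase, because the derivation
is indexed by a renamed judgment. -/
theorem Derives.of_rename_about {s : Cat} {M : Syn S s} :
    ∀ {J : Judgment S} {f : ℕ → ℕ} {Γ Δ : List (Ty S.Base)}, J.About M →
      RenReflects f Γ Δ → Derives S Γ (J.rename f) → Derives S Δ J := by
  induction M with
  | var i => rintro _ f Γ Δ ⟨⟩ hf ⟨h⟩; exact .var (hf _ _ h)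
  | lam M ih =>
    rintro _ f Γ Δ ⟨⟩ hf h
    cases h with | lam h => exact .lam (ih .exp (hf.lift _) h)
  | app M N ih₁ ih₂ =>
    rintro _ f Γ Δ ⟨⟩ hf h
    cases h with | app h₁ h₂ => exact .app (ih₁ .exp hf h₁) (ih₂ .exp hf h₂)
  | letE M N ih₁ ih₂ =>
    rintro _ f Γ Δ ⟨⟩ hf h
    cases h with | letE h₁ h₂ => exact .letE (ih₁ .exp hf h₁) (ih₂ .exp (hf.lift _) h₂)
  | fix M ih =>
    rintro _ f Γ Δ ⟨⟩ hf h
    cases h with | fix h => exact .fix (ih .exp (hf.lift _) h)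
  | new M ih =>
    rintro _ f Γ Δ ⟨⟩ hf h
    cases h with | new h o => exact .new (ih .exp (hf.lift _) h) o
  | back M ih =>
    rintro _ f Γ Δ ⟨⟩ hf h
    cases h with | back h o => exact .back (ih .exp (hf.lift _) h) o
  | arob M N ih₁ ih₂ =>
    rintro _ f Γ Δ ⟨⟩ hf h
    cases h with | arob h₁ h₂ => exact .arob (ih₁ .exp hf h₁) (ih₂ .exp hf h₂)
  | variant c Ms ih =>
    rintro _ f Γ Δ ⟨⟩ hf h
    cases h with | variant h => exact .variant (ih .exps hf h)
  | pair M N ih₁ ih₂ =>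
    rintro _ f Γ Δ ⟨⟩ hf h
    cases h with | pair h₁ h₂ => exact .pair (ih₁ .exp hf h₁) (ih₂ .exp hf h₂)
  | case T Rs ih₁ ih₂ =>
    rintro _ f Γ Δ ⟨⟩ hf h
    cases h with | case h₁ h₂ => exact .case (ih₁ .exp hf h₁) (ih₂ .rules hf h₂)
  | int n => rintro _ f Γ Δ ⟨⟩ - ⟨⟩; exact .int
  | special o M N ih₁ ih₂ =>
    rintro _ f Γ Δ ⟨⟩ hf h
    cases h with | special h₁ h₂ => exact .special (ih₁ .exp hf h₁) (ih₂ .exp hf h₂)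
  | nil => rintro _ f Γ Δ ⟨⟩ - ⟨⟩; exact .nil
  | cons M Ms ih₁ ih₂ =>
    rintro _ f Γ Δ ⟨⟩ hf h
    cases h with | cons h₁ h₂ => exact .cons (ih₁ .exp hf h₁) (ih₂ .exps hf h₂)
  | pvar M ih =>
    rintro _ f Γ Δ ⟨⟩ hf h
    cases h with | pvar h => exact .pvar (ih .exp hf h)
  | pnom M ih =>
    rintro _ f Γ Δ ⟨⟩ hf h
    cases h with | pnom h => exact .pnom (ih .exp hf h)
  | pvariant c ps ih =>
    rintro _ f Γ Δ ⟨⟩ hf h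
    cases h with | pvariant h => exact .pvariant (ih .pats hf h)
  | ppair p q ih₁ ih₂ =>
    rintro _ f Γ Δ ⟨⟩ hf h
    cases h with | ppair h₁ h₂ => exact .ppair (ih₁ .pat hf h₁) (ih₂ .pat hf h₂)
  | pback p ih =>
    rintro _ f Γ Δ ⟨⟩ hf h
    cases h with | pback h o => exact .pback (ih .pat (hf.lift _) h) o
  | parob p M ih₁ ih₂ =>
    rintro _ f Γ Δ ⟨⟩ hf h
    cases h with | parob h₁ h₂ o => exact .parob (ih₁ .pat hf h₁) (ih₂ .exp hf h₂) o
  | pint n => rintro _ f Γ Δ ⟨⟩ - ⟨⟩; exact .pint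
  | pwild => rintro _ f Γ Δ ⟨⟩ - ⟨⟩; exact .pwild
  | pnil => rintro _ f Γ Δ ⟨⟩ - ⟨⟩; exact .pnil
  | pcons p ps ih₁ ih₂ =>
    rintro _ f Γ Δ ⟨⟩ hf h
    cases h with | pcons h₁ h₂ => exact .pcons (ih₁ .pat hf h₁) (ih₂ .pats hf h₂)
  | all R ih =>
    rintro _ f Γ Δ ⟨⟩ hf h
    cases h with | all h => exact .all (ih .rule (hf.lift _) h)
  | nab R ih =>
    rintro _ f Γ Δ ⟨⟩ hf h
    cases h with | nab h o => exact .nab (ih .rule (hf.lift _) h) o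
  | body p u ih₁ ih₂ =>
    rintro _ f Γ Δ ⟨⟩ hf h
    cases h with | body h₁ h₂ => exact .body (ih₁ .pat hf h₁) (ih₂ .exp hf h₂)
  | rnil => rintro _ f Γ Δ ⟨⟩ - ⟨⟩; exact .rnil
  | rcons R Rs ih₁ ih₂ =>
    rintro _ f Γ Δ ⟨⟩ hf h
    cases h with | rcons h₁ h₂ => exact .rcons (ih₁ .rule hf h₁) (ih₂ .rules hf h₂)

theorem HasType.of_rename {M : Exp S} {A : Ty S.Base} {f : ℕ → ℕ} {Γ Δ : List (Ty S.Base)}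
    (hf : RenReflects f Γ Δ) (h : HasType Γ (M.rename f) A) : HasType Δ M A :=
  Derives.of_rename_about (J := .exp M A) .exp hf h

/-! ### Stability of the restrictions -/

/-- A flexible subpattern uses only indices below `b + n`, all bound by the clause, so no
substitution from outside reaches it. -/
theorem Flex.subst {b n : ℕ} {p : Pat S} {xs : List ℕ} (h : Flex b n p xs) (σ : ℕ → Exp S) :
    p.subst (liftSub^[b + n] σ) = p := by
  induction h with
  | pvar _ h => simp [Syn.subst, liftSub_iterate_of_lt σ h]
  | @parob p xs i _ h _ ih =>
    simp [Syn.subst, liftSub_iterate_of_lt σ (show i < b + n by omega), ih]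

theorem PatScoped.subst {n b : ℕ} {s : Cat} {p : Syn S s} (h : PatScoped n b p)
    (σ : ℕ → Exp S) : PatScoped n b (p.subst (liftSub^[b + n] σ)) := by
  induction h with
  | flex h => rw [h.subst]; exact .flex h
  | @localNom b i h =>
    rw [Syn.subst, Syn.subst, liftSub_iterate_of_lt σ (by omega)]
    exact .localNom h
  | @ambientNom b M N h =>
    -- An ambient nominal may become an arbitrary term, but one that is weakened past all binders of
    -- the clause.
    refine .ambientNom (N := N.subst σ) ?_
    rw [h, Syn.subst_rename, Syn.rename_subst]
    congr 1
    funext i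
    exact liftSub_iterate_add σ (b + n) i
  | pvariant _ ih => exact .pvariant ih
  | ppair _ _ ih₁ ih₂ => exact .ppair ih₁ ih₂
  | @pback b p _ ih =>
    refine .pback ?_
    rwa [Nat.add_right_comm, Function.iterate_succ_apply'] at ih
  | pint => exact .pint
  | pwild => exact .pwild
  | pnil => exact .pnil
  | pcons _ _ ih₁ ih₂ => exact .pcons ih₁ ih₂

theorem PatScoped.occ_subst {n b : ℕ} {s : Cat} {p : Syn S s} (h : PatScoped n b p)
    (σ : ℕ → Exp S) (i : ℕ) : (p.subst (liftSub^[b + n] σ)).occ i = p.occ i := by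
  induction h generalizing i with
  | flex h => rw [h.subst]
  | localNom | ambientNom | pint | pwild | pnil => rfl
  | pvariant _ ih => exact ih i
  | ppair _ _ ih₁ ih₂ => exact congrArg₂ (· + ·) (ih₁ i) (ih₂ i)
  | @pback b p _ ih =>
    have := ih (i + 1)
    rwa [Nat.add_right_comm, Function.iterate_succ_apply'] at this
  | pcons _ _ ih₁ ih₂ => exact congrArg₂ (· + ·) (ih₁ i) (ih₂ i)

theorem Rigid.subst {i : ℕ} {s : Cat} {p : Syn S s} (h : Rigid i p) :
    ∀ {σ : ℕ → Exp S}, σ i = .var i → Rigid i (p.subst σ) := by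
  induction h with
  | pnom =>
    intro σ hσ
    rw [Syn.subst, Syn.subst, hσ]
    exact .pnom
  | pvariant _ ih => exact fun hσ => .pvariant (ih hσ)
  | ppairLeft _ ih => exact fun hσ => .ppairLeft (ih hσ)
  | ppairRight _ ih => exact fun hσ => .ppairRight (ih hσ)
  | pback _ ih => exact fun hσ => .pback (ih (by rw [liftSub, hσ]; rfl))
  | pconsHead _ ih => exact fun hσ => .pconsHead (ih hσ)
  | pconsTail _ ih => exact fun hσ => .pconsTail (ih hσ)

theorem ClauseOK.subst {R : Rule S} (h : ClauseOK R) (σ : ℕ → Exp S) :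
    ClauseOK (R.subst σ) := by
  obtain ⟨n, m, p, u, rfl, hp, hocc, hrig⟩ := h
  refine ⟨n, m, p.subst (liftSub^[m + n] σ), u.subst (liftSub^[m + n] σ), ?_, hp.subst σ,
    fun i h₁ h₂ => (hp.occ_subst σ i).trans (hocc i h₁ h₂),
    fun i hi => (hrig i hi).subst (liftSub_iterate_of_lt σ (by omega))⟩
  rw [alls_subst, nabs_subst, Syn.subst, Function.iterate_add_apply]

theorem Syn.Restricted.rename {s : Cat} {M : Syn S s} :
    ∀ {f : ℕ → ℕ}, M.Restricted → (M.rename f).Restricted := by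
  induction M with
  | rcons R Rs ih₁ ih₂ =>
    rintro f ⟨h₀, h₁, h₂⟩
    refine ⟨?_, ih₁ h₁, ih₂ h₂⟩
    rw [Syn.rename_eq_subst]
    exact h₀.subst _
  | _ => simp_all [Syn.Restricted, Syn.rename]

/-- An injective renaming is undone by another renaming, and the restrictions are stable under all
of them. -/
theorem Syn.Restricted.of_rename {s : Cat} {M : Syn S s} {f : ℕ → ℕ} (hf : f.Injective)
    (h : (M.rename f).Restricted) : M.Restricted := by
  rw [← Syn.rename_invFun hf M]
  exact h.rename

theorem restricted_liftSub {σ : ℕ → Exp S} (h : ∀ i, (σ i).Restricted) (i : ℕ) :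
    (liftSub σ i).Restricted := by
  cases i with
  | zero => trivial
  | succ i => exact (h i).rename

theorem Syn.Restricted.subst {s : Cat} {M : Syn S s} :
    ∀ {σ : ℕ → Exp S}, (∀ i, (σ i).Restricted) → M.Restricted → (M.subst σ).Restricted := by
  induction M with
  | rcons R Rs ih₁ ih₂ =>
    rintro σ hσ ⟨h₀, h₁, h₂⟩
    exact ⟨h₀.subst _, ih₁ hσ h₁, ih₂ hσ h₂⟩
  | _ => simp_all [Syn.Restricted, Syn.subst, restricted_liftSub]

theorem Syn.Restricted.inst {s : Cat} {M : Syn S s} {N : Exp S} (hM : M.Restricted)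
    (hN : N.Restricted) : (M.inst N).Restricted :=
  hM.subst fun i => by cases i <;> [exact hN; trivial]

theorem restricted_liftSub_iterate {σ : ℕ → Exp S} (h : ∀ i, (σ i).Restricted) (b i : ℕ) :
    (liftSub^[b] σ i).Restricted := by
  induction b generalizing i with
  | zero => exact h i
  | succ b ih => rw [Function.iterate_succ_apply']; exact restricted_liftSub ih i

theorem restricted_alls {n : ℕ} {R : Rule S} : (alls n R).Restricted ↔ R.Restricted := by
  induction n with
  | zero => rfl
  | succ n ih => exact ih

theorem restricted_nabs {n : ℕ} {R : Rule S} : (nabs n R).Restricted ↔ R.Restricted := by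
  induction n with
  | zero => rfl
  | succ n ih => exact ih

/-! ### Inversion of clauses -/

theorem derives_alls {n : ℕ} {R : Rule S} {A B : Ty S.Base} {Γ : List (Ty S.Base)}
    (h : Derives S Γ (.rule A (alls n R) B)) :
    ∃ Cs : List (Ty S.Base), Cs.length = n ∧ Derives S (Cs ++ Γ) (.rule A R B) := by
  induction n generalizing Γ with
  | zero => exact ⟨[], rfl, h⟩
  | succ n ih =>
    cases h with | @all _ _ _ _ C h =>
    obtain ⟨Cs, hl, h⟩ := ih h
    -- The outermost binder has the largest index, so its type goes last.
    exact ⟨Cs ++ [C], by simp [hl], by simpa using h⟩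

theorem derives_nabs {n : ℕ} {R : Rule S} {A B : Ty S.Base} {Γ : List (Ty S.Base)}
    (h : Derives S Γ (.rule A (nabs n R) B)) :
    ∃ Ds : List (Ty S.Base), Ds.length = n ∧ (∀ D ∈ Ds, OpenTy S D) ∧
      Derives S (Ds ++ Γ) (.rule A R B) := by
  induction n generalizing Γ with
  | zero => exact ⟨[], rfl, by simp, h⟩
  | succ n ih =>
    cases h with | @nab _ _ _ _ D h hD =>
    obtain ⟨Ds, hl, ho, h⟩ := ih h
    refine ⟨Ds ++ [D], by simp [hl], ?_, by simpa using h⟩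
    simp only [List.mem_append, List.mem_singleton]
    rintro D' (hD' | rfl)
    exacts [ho _ hD', hD]

/-- The matching rule chooses its own splitting into prefix and body; this makes the splitting
unique. -/
theorem nabs_body_injective {m m' : ℕ} {p p' : Pat S} {u u' : Exp S}
    (h : nabs m (.body p u) = nabs m' (.body p' u')) : m = m' ∧ p = p' ∧ u = u' := by
  induction m generalizing m' with
  | zero => cases m' <;> simp_all [nabs]
  | succ m ih =>
    cases m' with
    | zero => simp [nabs] at h
    | succ m' =>
      obtain ⟨rfl, hp, hu⟩ := ih (Syn.nab.inj h)
      exact ⟨rfl, hp, hu⟩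

theorem Clause.of_all {T U : Exp S} {R : Rule S} (h : Clause T (.all R) U) :
    ∃ x, Clause T (R.inst x) U := by
  generalize hR : Syn.all R = R' at h
  cases h with
  | all x h => cases hR; exact ⟨x, h⟩
  | @nabs m => cases m <;> simp [MLTS.nabs] at hR

theorem Clause.of_nabs {T U u : Exp S} {m : ℕ} {p : Pat S}
    (h : Clause T (MLTS.nabs m (.body p u)) U) :
    ∃ P, Matches T P ∧ NominalAbstraction m (.body p u) (.body P U) := by
  generalize hR : MLTS.nabs m (.body p u) = R' at h
  cases h with
  | all x h => cases m <;> simp [MLTS.nabs] at hR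
  | nabs hm hn =>
    obtain ⟨rfl, rfl, rfl⟩ := nabs_body_injective hR
    exact ⟨_, hm, hn⟩

/-- The successive choices of instances are accumulated into one simultaneous substitution, whose
first `n` entries are the instances. -/
theorem Clause.of_alls {T U : Exp S} {n : ℕ} {R : Rule S} {σ : ℕ → Exp S}
    (h : Clause T ((alls n R).subst σ) U) :
    ∃ τ : ℕ → Exp S, (∀ i, τ (i + n) = σ i) ∧ Clause T (R.subst τ) U := by
  induction n generalizing σ with
  | zero => exact ⟨σ, fun _ => rfl, h⟩
  | succ n ih =>
    obtain ⟨x, h⟩ := h.of_all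
    rw [Syn.inst_liftSub] at h
    obtain ⟨τ, hτ, h⟩ := ih h
    refine ⟨τ, fun i => ?_, h⟩
    rw [← Nat.add_assoc, Nat.add_right_comm]
    exact hτ (i + 1)

/-! ### Matching -/

/-- Any renaming works, even a non-injective one: matching only asks for equalities, never for
distinctness of nominals. -/
theorem Matches.rename {s s' : Cat} {T : Syn S s} {P : Syn S s'} (h : Matches T P) :
    ∀ f : ℕ → ℕ, Matches (T.rename f) (P.rename f) := by
  induction h with
  | variant _ ih => exact fun f => .variant (ih f)
  | nil => exact fun _ => .nil
  | cons _ _ ih₁ ih₂ => exact fun f => .cons (ih₁ f) (ih₂ f)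
  | pair _ _ ih₁ ih₂ => exact fun f => .pair (ih₁ f) (ih₂ f)
  | int => exact fun _ => .int
  | wild => exact fun _ => .wild
  | nom => exact fun _ => .nom
  | pvar => exact fun _ => .pvar
  | back _ ih => exact fun f => .back (ih _)
  | @arob T R p c h _ ih =>
    exact fun f => .arob (R := R.rename (liftRen f)) (by rw [h, Syn.rename_inst_var]) (ih f)

/-- The typing of expressions, patterns and lists of these, with a list of types. -/
inductive Types (Γ : List (Ty S.Base)) : {s : Cat} → Syn S s → List (Ty S.Base) → Prop
  | exp {M : Exp S} {A} : Derives S Γ (.exp M A) → Types Γ M [A]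
  | exps {Ms : Syn S .exps} {As} : Derives S Γ (.exps Ms As) → Types Γ Ms As
  | pat {p : Pat S} {A} : Derives S Γ (.pat p A) → Types Γ p [A]
  | pats {ps : Syn S .pats} {As} : Derives S Γ (.pats ps As) → Types Γ ps As

/-- A nominal with a rigid occurrence in a pattern has the same type in the matched term. -/
theorem Rigid.type_eq {i : ℕ} {s : Cat} {p : Syn S s} (h : Rigid i p) :
    ∀ {s' : Cat} {T : Syn S s'} {σ : ℕ → Exp S} {Γ Δ As : List (Ty S.Base)},
      σ i = .var i → Types Γ T As → Types Δ p As → Matches T (p.subst σ) → Γ[i]? = Δ[i]? := by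
  induction h with
  | @pnom i =>
    intro s' T σ Γ Δ As hσ hT hp hM
    rw [Syn.subst, Syn.subst, hσ] at hM
    cases hM
    cases hT with | exp hT => cases hT with | var hT =>
    cases hp with | pat hp => cases hp with | pnom hp => cases hp with | var hp =>
    rw [hT, hp]
  | pvariant _ ih =>
    intro s' T σ Γ Δ As hσ hT hp hM
    cases hM with | variant hM =>
    cases hT with | exp hT => cases hT with | variant hT =>
    cases hp with | pat hp => cases hp with | pvariant hp =>
    exact ih hσ (.exps hT) (.pats hp) hM
  | ppairLeft _ ih =>
    intro s' T σ Γ Δ As hσ hT hp hM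
    cases hM with | pair hM _ =>
    cases hT with | exp hT => cases hT with | pair hT _ =>
    cases hp with | pat hp => cases hp with | ppair hp _ =>
    exact ih hσ (.exp hT) (.pat hp) hM
  | ppairRight _ ih =>
    intro s' T σ Γ Δ As hσ hT hp hM
    cases hM with | pair _ hM =>
    cases hT with | exp hT => cases hT with | pair _ hT =>
    cases hp with | pat hp => cases hp with | ppair _ hp =>
    exact ih hσ (.exp hT) (.pat hp) hM
  | pback _ ih =>
    intro s' T σ Γ Δ As hσ hT hp hM
    cases hM with | back hM =>
    cases hT with | exp hT => cases hT with | back hT _ =>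
    -- The common type forces the same type for the bound nominal on both sides, so both contexts
    -- grow by the same entry.
    cases hp with | pat hp => cases hp with | pback hp _ =>
    exact ih (σ := liftSub σ) (by rw [liftSub, hσ]; rfl) (.exp hT) (.pat hp) hM
  | pconsHead _ ih =>
    intro s' T σ Γ Δ As hσ hT hp hM
    cases hM with | cons hM _ =>
    cases hT with | exps hT => cases hT with | cons hT _ =>
    cases hp with | pats hp => cases hp with | pcons hp _ =>
    exact ih hσ (.exp hT) (.pat hp) hM
  | pconsTail _ ih =>
    intro s' T σ Γ Δ As hσ hT hp hM
    cases hM with | cons _ hM =>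
    cases hT with | exps hT => cases hT with | cons _ hT =>
    cases hp with | pats hp => cases hp with | pcons _ hp =>
    exact ih hσ (.exps hT) (.pats hp) hM

/-- A term matched by `x @ X₁ … Xⱼ` is a renaming of the body of the `j`-fold abstraction that
instantiates the pattern variable `x`. -/
theorem Flex.solution {b n k : ℕ} {p : Pat S} {xs : List ℕ} (h : Flex b n p xs)
    {τ : ℕ → Exp S} {Λ Cs Γ : List (Ty S.Base)} (hΛ : Λ.length = b) (hCs : Cs.length = n)
    (hk : p.occ (k + b) ≠ 0) :
    ∀ {T : Exp S} {B : Ty S.Base}, Derives S (Λ ++ (Cs ++ Γ)) (.pat p B) →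
      Matches T (p.subst (liftSub^[b] τ)) →
      ∃ (C : Ty S.Base) (M : Exp S) (Ξ : List (Ty S.Base)) (g : ℕ → ℕ),
        Cs[k]? = some C ∧ T = M.rename g ∧ g.Injective ∧ (∀ i, g i ∈ xs ∨ b ≤ g i) ∧
        RenReflects g (Λ ++ Γ) Ξ ∧ (HasType Ξ M B → HasType Γ (τ k) C) ∧
        (M.Restricted → (τ k).Restricted) := by
  induction h with
  | @pvar i h₁ h₂ =>
    intro T B hp hM
    have hi : k + b = i := by
      by_contra hne
      exact hk (if_neg hne)
    subst hi
    cases hp with | pvar hp => cases hp with | var hp =>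
    -- With no arguments, the matched term is `τ k` weakened by `b`; hence `g = (· + b)`.
    rw [Syn.subst, Syn.subst, liftSub_iterate_add] at hM
    cases hM
    rw [List.getElem?_append_right (by omega), List.getElem?_append_left (by omega), hΛ,
      Nat.add_sub_cancel] at hp
    refine ⟨B, τ k, Γ, (· + b), hp, rfl, add_left_injective b,
      fun i => Or.inr (Nat.le_add_left b i), ?_, id, id⟩
    intro i A hA
    change (Λ ++ Γ)[i + b]? = some A at hA
    rwa [List.getElem?_append_right (by omega), hΛ, Nat.add_sub_cancel] at hA
  | @parob p xs c hf hc hxs ih =>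
    intro T B hp hM
    cases hp with | @parob _ _ _ A _ hp hv o => cases hv with | var hv =>
    rw [Syn.subst, Syn.subst, liftSub_iterate_of_lt τ hc] at hM
    cases hM with | @arob _ R _ _ hT hM =>
    obtain ⟨C, M, Ξ, g, hC, hR, hg, hx, hrefl, hty, hres⟩ := ih hk hp hM
    -- `M` renames to a backslash, so it is one itself.
    cases M <;> simp only [Syn.rename, reduceCtorEq, Syn.back.injEq] at hR
    rename_i M
    -- The new argument `c` is local and differs from the earlier ones, so `g` can be extended
    -- injectively by sending the stripped bound variable to `c`.
    have hcg : ∀ i, g i ≠ c := by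
      rintro i rfl
      rcases hx i with h | h
      · exact hxs h
      · omega
    refine ⟨C, M, A :: Ξ, fun i => Nat.casesOn i c g, hC, ?_, ?_, ?_, ?_,
      fun hM => hty (.back hM o), hres⟩
    · rw [hT, hR, Syn.inst_var, Syn.rename_rename]
      congr 1
      funext i; cases i <;> rfl
    · rintro (_ | i) (_ | j) hij
      · rfl
      · exact absurd hij.symm (hcg j)
      · exact absurd hij (hcg i)
      · exact congrArg Nat.succ (hg hij)
    · rintro (_ | i)
      · exact Or.inl (List.mem_cons_self ..)
      · exact (hx i).imp_left (List.mem_cons_of_mem _)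
    · rintro (_ | i) D hD
      -- Since `c < b`, its type lies in `Λ`, common to the contexts of pattern and term; the typing
      -- of `@` makes it `A`.
      · rw [List.getElem?_append_left (by omega)] at hv
        have hD : (Λ ++ Γ)[c]? = some D := hD
        rw [List.getElem?_append_left (by omega), hv] at hD
        exact hD
      · exact hrefl i D hD

/-- Matching instantiates the pattern variables that occur in the pattern with typed terms. -/
theorem PatScoped.solution {n k b : ℕ} {s : Cat} {p : Syn S s} (h : PatScoped n b p)
    {τ : ℕ → Exp S} {Cs Γ : List (Ty S.Base)} (hCs : Cs.length = n) :
    ∀ {s' : Cat} {T : Syn S s'} {Λ As : List (Ty S.Base)}, Λ.length = b → T.Restricted →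
      Types (Λ ++ Γ) T As → Types (Λ ++ (Cs ++ Γ)) p As →
      Matches T (p.subst (liftSub^[b] τ)) → p.occ (k + b) ≠ 0 →
      (∃ C, Cs[k]? = some C ∧ HasType Γ (τ k) C) ∧ (τ k).Restricted := by
  induction h with
  | flex hf =>
    intro s' T Λ As hΛ hr hT hp hM hk
    cases hp with | pat hp =>
    cases hT with
    | exp hT =>
      obtain ⟨C, M, Ξ, g, hC, rfl, hg, -, hrefl, hty, hres⟩ := hf.solution hΛ hCs hk hp hM
      exact ⟨⟨C, hC, hty (HasType.of_rename hrefl hT)⟩, hres (hr.of_rename hg)⟩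
    | _ => cases hf <;> cases hM
  | localNom | ambientNom | pint | pwild | pnil =>
    intro s' T Λ As hΛ hr hT hp hM hk
    exact absurd rfl hk
  | pvariant _ ih =>
    intro s' T Λ As hΛ hr hT hp hM hk
    cases hM with | @variant _ Ts _ hM =>
    cases hT with | exp hT => cases hT with | variant hT =>
    cases hp with | pat hp => cases hp with | pvariant hp =>
    exact ih (T := Ts) hΛ hr (.exps hT) (.pats hp) hM hk
  | ppair _ _ ih₁ ih₂ =>
    intro s' T Λ As hΛ hr hT hp hM hk
    cases hM with | pair hM₁ hM₂ =>
    cases hT with | exp hT => cases hT with | pair hT₁ hT₂ =>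
    cases hp with | pat hp => cases hp with | ppair hp₁ hp₂ =>
    -- The variable occurs in at least one component, and one suffices.
    rcases (Nat.add_eq_zero_iff.not.trans not_and_or).mp hk with hk | hk
    · exact ih₁ hΛ hr.1 (.exp hT₁) (.pat hp₁) hM₁ hk
    · exact ih₂ hΛ hr.2 (.exp hT₂) (.pat hp₂) hM₂ hk
  | pback _ ih =>
    intro s' T Λ As hΛ hr hT hp hM hk
    cases hM with | @back T _ hM =>
    cases hT with | exp hT => cases hT with | @back _ _ A _ hT _ =>
    cases hp with | pat hp => cases hp with | pback hp _ =>
    refine ih (T := T) (Λ := A :: Λ) (congrArg Nat.succ hΛ) hr (.exp hT) (.pat hp) ?_ hk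
    rwa [Function.iterate_succ_apply']
  | pcons _ _ ih₁ ih₂ =>
    intro s' T Λ As hΛ hr hT hp hM hk
    cases hM with | cons hM₁ hM₂ =>
    cases hT with | exps hT => cases hT with | cons hT₁ hT₂ =>
    cases hp with | pats hp => cases hp with | pcons hp₁ hp₂ =>
    rcases (Nat.add_eq_zero_iff.not.trans not_and_or).mp hk with hk | hk
    · exact ih₁ hΛ hr.1 (.exp hT₁) (.pat hp₁) hM₁ hk
    · exact ih₂ hΛ hr.2 (.exps hT₂) (.pats hp₂) hM₂ hk

/-! ### Nominal abstraction -/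

theorem absVar_injective (cs : List ℕ) : (absVar cs).Injective := by
  intro v w h
  unfold absVar at h
  split_ifs at h with hv hw hw
  · exact (List.idxOf_inj hv).mp h
  · have := List.idxOf_lt_length_of_mem hv; omega
  · have := List.idxOf_lt_length_of_mem hw; omega
  · omega

/-- The types of the nominals `cs` in `Γ`; those out of scope get the type `int`, which is not
open. -/
def nominalTypes (Γ : List (Ty S.Base)) (cs : List ℕ) : List (Ty S.Base) :=
  cs.map fun c => Γ[c]?.getD .int

theorem nominalTypes_absVar_of_mem (Γ : List (Ty S.Base)) {cs : List ℕ} {v : ℕ} (h : v ∈ cs) :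
    (nominalTypes Γ cs ++ Γ)[absVar cs v]? = some (Γ[v]?.getD .int) := by
  have hlt := List.idxOf_lt_length_of_mem h
  rw [absVar, if_pos h, List.getElem?_append_left (by simpa [nominalTypes] using hlt)]
  simp [nominalTypes, hlt]

theorem nominalTypes_absVar_of_notMem (Γ : List (Ty S.Base)) {cs : List ℕ} {v : ℕ}
    (h : v ∉ cs) : (nominalTypes Γ cs ++ Γ)[absVar cs v]? = Γ[v]? := by
  rw [absVar, if_neg h, List.getElem?_append_right (by simp [nominalTypes])]
  simp [nominalTypes]

/-- The nominals in `cs` move to the new front entries; their old positions in `Γ` stay but are no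
longer referred to. -/
theorem renTyped_absVar (Γ : List (Ty S.Base)) (cs : List ℕ) :
    RenTyped (absVar cs) Γ (nominalTypes Γ cs ++ Γ) := by
  intro v A hA
  by_cases h : v ∈ cs
  · rw [nominalTypes_absVar_of_mem Γ h, hA]; rfl
  · rwa [nominalTypes_absVar_of_notMem Γ h]

/-- The only obstacle is an out-of-scope nominal that received the default type; that type is not
open, so it is excluded. -/
theorem renReflects_absVar {Γ : List (Ty S.Base)} {cs : List ℕ}
    (ho : ∀ D ∈ nominalTypes Γ cs, OpenTy S D) :
    RenReflects (absVar cs) (nominalTypes Γ cs ++ Γ) Γ := by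
  intro v A hA
  by_cases h : v ∈ cs
  · rw [nominalTypes_absVar_of_mem Γ h] at hA
    have := ho _ (List.mem_map_of_mem h)
    cases hv : Γ[v]? with
    | none => rw [hv] at this; cases this
    | some B => rwa [hv] at hA
  · rwa [nominalTypes_absVar_of_notMem Γ h] at hA

theorem SubTyped.lift_iterate {σ : ℕ → Exp S} {Γ Δ : List (Ty S.Base)} (h : SubTyped σ Γ Δ)
    (Λ : List (Ty S.Base)) : SubTyped (liftSub^[Λ.length] σ) (Λ ++ Γ) (Λ ++ Δ) := by
  induction Λ with
  | nil => exact h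
  | cons A Λ ih =>
    rw [List.length_cons, Function.iterate_succ_apply']
    exact ih.lift A

theorem Clause.preservation {T U : Exp S} {R : Rule S} {A B : Ty S.Base} {Γ : List (Ty S.Base)}
    (h : Clause T R U) (hR : ClauseOK R) (hRr : R.Restricted) (hRt : Derives S Γ (.rule A R B))
    (hTr : T.Restricted) (hT : HasType Γ T A) : HasType Γ U B ∧ U.Restricted := by
  obtain ⟨n, m, p, u, rfl, hp, hocc, hrig⟩ := hR
  obtain ⟨-, hur⟩ := restricted_nabs.mp (restricted_alls.mp hRr)
  obtain ⟨Cs, rfl, hnabs⟩ := derives_alls hRt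
  obtain ⟨Ds, rfl, hDs, hbody⟩ := derives_nabs hnabs
  cases hbody with | body hpt hut =>
  -- The identity substitution starts the accumulation, so `τ` is the identity on ambient indices.
  rw [← Syn.subst_var (alls _ _)] at h
  obtain ⟨τ, hτ, h⟩ := h.of_alls
  rw [nabs_subst] at h
  obtain ⟨P, hM, cs, hcs, -, heq⟩ := h.of_nabs
  obtain ⟨hP, hU⟩ := Syn.body.inj heq
  replace hM := hM.rename (absVar cs)
  rw [← hP] at hM
  have hT' : HasType _ _ A := Derives.rename hT (renTyped_absVar Γ cs)
  -- Each `nab`-bound nominal occurs rigidly, so the guessed nominals have exactly the declared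
  -- types, in particular open ones.
  have hDeq : nominalTypes Γ cs = Ds := by
    have hl : (nominalTypes Γ cs).length = Ds.length := by simpa [nominalTypes] using hcs
    refine List.ext_getElem? fun i => ?_
    by_cases hi : i < Ds.length
    · have := (hrig i hi).type_eq (liftSub_iterate_of_lt τ hi) (.exp hT') (.pat hpt) hM
      rwa [List.getElem?_append_left (by omega), List.getElem?_append_left hi] at this
    · rw [List.getElem?_eq_none (by omega), List.getElem?_eq_none (by omega)]
  have hrefl : RenReflects (absVar cs) (nominalTypes Γ cs ++ Γ) Γ :=
    renReflects_absVar (by rwa [hDeq])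
  rw [hDeq] at hT' hrefl
  -- Each pattern variable occurs in `p`, so its instance is determined by the scrutinee.
  have hsol : ∀ k, k < Cs.length →
      (∃ C, Cs[k]? = some C ∧ HasType Γ (τ k) C) ∧ (τ k).Restricted := fun k hk =>
    hp.solution rfl rfl hTr.rename (.exp hT') (.pat hpt) hM
      (by rw [hocc _ (by omega) (by omega)]; exact one_ne_zero)
  have hτt : SubTyped τ (Cs ++ Γ) Γ := by
    intro i C hi
    by_cases hlt : i < Cs.length
    · obtain ⟨⟨C', hC', ht⟩, -⟩ := hsol i hlt
      rw [List.getElem?_append_left hlt, hC'] at hi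
      cases hi
      exact ht
    · obtain ⟨j, rfl⟩ := Nat.exists_eq_add_of_le' (Nat.le_of_not_lt hlt)
      rw [List.getElem?_append_right (by omega), Nat.add_sub_cancel] at hi
      rw [hτ]
      exact .var hi
  have hτr : ∀ i, (τ i).Restricted := by
    intro i
    by_cases hlt : i < Cs.length
    · exact (hsol i hlt).2
    · obtain ⟨j, rfl⟩ := Nat.exists_eq_add_of_le' (Nat.le_of_not_lt hlt)
      rw [hτ]
      trivial
  constructor
  · refine HasType.of_rename hrefl ?_
    rw [← hU]
    exact Derives.subst hut (hτt.lift_iterate Ds)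
  · refine Syn.Restricted.of_rename (absVar_injective cs) ?_
    rw [← hU]
    exact hur.subst (restricted_liftSub_iterate hτr _)

/-! ### Type preservation -/

/-- The context varies because evaluation goes under `new` and `back`. -/
theorem Eval.preservation {σ : Scrutinee} {s : Cat} {E V : Syn S s} (h : Eval σ E V) :
    ∀ {Γ As : List (Ty S.Base)}, E.Restricted → Types Γ E As → Types Γ V As ∧ V.Restricted := by
  induction h with
  | nom | lam | nil | int => exact fun hr ht => ⟨ht, hr⟩
  | variant _ ih =>
    intro Γ As hr ht
    cases ht with | exp ht => cases ht with | variant ht =>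
    obtain ⟨ht, hr⟩ := ih hr (.exps ht)
    cases ht with | exps ht =>
    exact ⟨.exp (.variant ht), hr⟩
  | cons _ _ ih₁ ih₂ =>
    intro Γ As hr ht
    cases ht with | exps ht => cases ht with | cons ht₁ ht₂ =>
    obtain ⟨ht₁, hr₁⟩ := ih₁ hr.1 (.exp ht₁)
    obtain ⟨ht₂, hr₂⟩ := ih₂ hr.2 (.exps ht₂)
    cases ht₁ with | exp ht₁ => cases ht₂ with | exps ht₂ =>
    exact ⟨.exps (.cons ht₁ ht₂), hr₁, hr₂⟩
  | pair _ _ ih₁ ih₂ =>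
    intro Γ As hr ht
    cases ht with | exp ht => cases ht with | pair ht₁ ht₂ =>
    obtain ⟨ht₁, hr₁⟩ := ih₁ hr.1 (.exp ht₁)
    obtain ⟨ht₂, hr₂⟩ := ih₂ hr.2 (.exp ht₂)
    cases ht₁ with | exp ht₁ => cases ht₂ with | exp ht₂ =>
    exact ⟨.exp (.pair ht₁ ht₂), hr₁, hr₂⟩
  | special _ _ _ _ =>
    intro Γ As hr ht
    cases ht with | exp ht => cases ht with | special _ _ =>
    exact ⟨.exp .int, trivial⟩
  | new _ ih =>
    intro Γ As hr ht
    cases ht with | exp ht => cases ht with | new ht _ =>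
    obtain ⟨ht, hr⟩ := ih hr (.exp ht)
    cases ht with | exp ht =>
    -- The value is a weakening, so the type of the fresh nominal can be dropped from the context.
    exact ⟨.exp (HasType.of_rename (f := Nat.succ) (fun _ _ hi => hi) ht),
      hr.of_rename Nat.succ_injective⟩
  | app _ _ _ ih₁ ih₂ ih₃ =>
    intro Γ As hr ht
    cases ht with | exp ht => cases ht with | app ht₁ ht₂ =>
    obtain ⟨ht₁, hr₁⟩ := ih₁ hr.1 (.exp ht₁)
    obtain ⟨ht₂, hr₂⟩ := ih₂ hr.2 (.exp ht₂)
    cases ht₁ with | exp ht₁ => cases ht₁ with | lam ht₁ => cases ht₂ with | exp ht₂ =>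
    exact ih₃ (Syn.Restricted.inst hr₁ hr₂) (.exp (HasType.inst ht₁ ht₂))
  | letE _ _ ih₁ ih₂ =>
    intro Γ As hr ht
    cases ht with | exp ht => cases ht with | letE ht₁ ht₂ =>
    obtain ⟨ht₁, hr₁⟩ := ih₁ hr.1 (.exp ht₁)
    cases ht₁ with | exp ht₁ =>
    exact ih₂ (Syn.Restricted.inst hr.2 hr₁) (.exp (HasType.inst ht₂ ht₁))
  | fix _ ih =>
    intro Γ As hr ht
    cases ht with | exp ht => cases ht with | fix ht =>
    exact ih (Syn.Restricted.inst hr hr) (.exp (HasType.inst ht (.fix ht)))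
  | arob _ _ ih₁ ih₂ =>
    intro Γ As hr ht
    cases ht with | exp ht => cases ht with | arob ht₁ ht₂ =>
    obtain ⟨ht₁, hr₁⟩ := ih₁ hr.1 (.exp ht₁)
    cases ht₁ with | exp ht₁ => cases ht₁ with | back ht₁ _ =>
    exact ih₂ (Syn.Restricted.inst hr₁ hr.2) (.exp (HasType.inst ht₁ ht₂))
  | back _ ih =>
    intro Γ As hr ht
    cases ht with | exp ht => cases ht with | back ht o =>
    obtain ⟨ht, hr⟩ := ih hr (.exp ht)
    cases ht with | exp ht =>
    exact ⟨.exp (.back ht o), hr⟩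
  | hit hc _ ih =>
    rintro Γ As ⟨hTr, hok, hRr, -⟩ ht
    cases ht with | exp ht => cases ht with | case hT hRs => cases hRs with | rcons hR _ =>
    obtain ⟨hU, hUr⟩ := hc.preservation hok hRr hR hTr hT
    exact ih hUr (.exp hU)
  | skip _ _ ih =>
    rintro Γ As ⟨hTr, -, -, hRsr⟩ ht
    cases ht with | exp ht => cases ht with | case hT hRs => cases hRs with | rcons _ hRs =>
    exact ih ⟨hTr, hRsr⟩ (.exp (.case hT hRs))
  | hitEval _ hc _ ih₁ ih₂ =>
    rintro Γ As ⟨hTr, hok, hRr, -⟩ ht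
    cases ht with | exp ht => cases ht with | case hT hRs => cases hRs with | rcons hR _ =>
    obtain ⟨hW, hWr⟩ := ih₁ hTr (.exp hT)
    cases hW with | exp hW =>
    obtain ⟨hU, hUr⟩ := hc.preservation hok hRr hR hWr hW
    exact ih₂ hUr (.exp hU)
  | skipEval _ _ _ ih₁ ih₂ =>
    rintro Γ As ⟨hTr, -, -, hRsr⟩ ht
    cases ht with | exp ht => cases ht with | case hT hRs => cases hRs with | rcons _ hRs =>
    obtain ⟨hW, hWr⟩ := ih₁ hTr (.exp hT)
    cases hW with | exp hW =>
    exact ih₂ ⟨hWr, hRsr⟩ (.exp (.case hW hRs))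

end MLTS

theorem mainTheorem2 (S : MLTS.Signature) (σ : MLTS.Scrutinee) (E V : MLTS.Exp S)
    (A : MLTS.Ty S.Base) (hR : E.Restricted) (hE : MLTS.HasType [] E A)
    (hV : MLTS.Eval σ E V) : MLTS.HasType [] V A := by
  cases (hV.preservation hR (.exp hE)).1 with | exp h => exact h
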